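/- Let $p$ be a prime and let $K/k$ be a purely inseparable extension of fields of characteristic $p$. For $n\ge 0$ put $k^{p^{-n}}\cap K=\{x\in K : x^{p^n}\in k\}$. The irrationality degree $di(K/k)$ is the supremum over $n$ of the cardinality of a minimal generating set of the extension $(k^{p^{-n}}\cap K)/k$ (all of its minimal generating sets have the same cardinality), and $K/k$ is called $q$-finite if $di(K/k)<\infty$. For an intermediate field $m$ of $K/k$, the extension $K/m$ is modular if for every $n\ge 0$ the fields $K^{p^n}$ and $m$ are linearly disjoint over $K^{p^n}\cap m$; it is $lq$-modular if $K$ is modular over some finite extension of $m$ contained in $K$. An extension $L/k$ is relatively perfect if $k(L^p)=L$; for an intermediate field $L$ of $K/k$, $rp(L/k)$ denotes the largest relatively perfect subextension of $L/k$. Assume that $K/k$ is $q$-finite. Then: 1. If $(k_i)_{i\in I}$ is any family of intermediate fields of $K/k$ such that $K/k_i$ is $lq$-modular for every $i\in I$, then $K/\bigcap_{i\in I}k_i$ is $lq$-modular (for $I=\emptyset$ the intersection is $K$). 2. There is a smallest intermediate field $lm(K/k)$ of $K/k$ over which $K$ is modular, and there is a smallest intermediate field $lqm(K/k)$ of $K/k$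 over which $K$ is $lq$-modular. 3. $lqm(K/k)=rp(lm(K/k)/k)$; in particular $lqm(K/k)/k$ is relatively perfect. -/

import Mathlib

namespace PurelyInsep

/-- `A` and `B` are linearly disjoint over `A ∩ B` (inside the ambient field `K`). -/
def LinearDisjointOverInf {K : Type*} [Field K] (A B : Subfield K) : Prop :=
  (Subfield.extendScalars (inf_le_left : A ⊓ B ≤ A)).LinearDisjoint
    (Subfield.extendScalars (inf_le_right : A ⊓ B ≤ B))

/-- The subfield `K ^ (p ^ n)` of `p ^ n`-th powers of `K`. -/
def powSubfield (p : ℕ) (K : Type*) [Field K] [ExpChar K p] (n : ℕ) : Subfield K :=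
  (iterateFrobenius K p n).fieldRange

/-- `K / F` is modular: for every `n`, the fields `K ^ (p ^ n)` and `F` are linearly disjoint
over their intersection. -/
def IsModular (p : ℕ) (F K : Type*) [Field F] [Field K] [Algebra F K] [ExpChar K p] : Prop :=
  ∀ n : ℕ, LinearDisjointOverInf (powSubfield p K n) (algebraMap F K).fieldRange

/-- `K / F` is lq-modular: `K` is modular over a finite extension of `F` (contained in `K`). -/
def IsLqModular (p : ℕ) (F K : Type*) [Field F] [Field K] [Algebra F K] [ExpChar K p] : Prop :=
  ∃ E : IntermediateField F K, FiniteDimensional F E ∧ IsModular p E K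

/-- The intermediate field `k ^ (p ^ (-n)) ∩ K` of `K / k`. -/
def rootField (p : ℕ) (k K : Type*) [Field k] [Field K] [Algebra k K] [ExpChar K p] (n : ℕ) :
    IntermediateField k K :=
  ((algebraMap k K).fieldRange.comap (iterateFrobenius K p n)).toIntermediateField
    fun x => ⟨x ^ p ^ n, by simp [iterateFrobenius_def]⟩

/-- `G` is a minimal generating set of `L / k`. -/
def IsMinimalGenerator {k K : Type*} [Field k] [Field K] [Algebra k K]
    (L : IntermediateField k K) (G : Set K) : Prop :=
  IntermediateField.adjoin k G = L ∧ ∀ x ∈ G, x ∉ IntermediateField.adjoin k (G \ {x})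

/-- The irrationality degree `di(K / k)`: the supremum over `n` of the cardinality of a minimal
generating set of `k ^ (p ^ (-n)) ∩ K` over `k`. All minimal generating sets of such a purely
inseparable extension of bounded exponent have the same cardinality; infinite cardinals are not
distinguished, and the infimum is only a way of selecting the common value. -/
noncomputable def irrDegree (p : ℕ) (k K : Type*) [Field k] [Field K] [Algebra k K]
    [ExpChar K p] : ℕ∞ :=
  ⨆ n : ℕ, ⨅ G : {G : Set K // IsMinimalGenerator (rootField p k K n) G}, (G : Set K).encard

/-- `K / k` is q-finite: purely inseparable of finite irrationality degree. -/
def IsQFinite (p : ℕ) (k K : Type*) [Field k] [Field K] [Algebra k K] [ExpChar K p] : Prop :=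
  IsPurelyInseparable k K ∧ irrDegree p k K ≠ ⊤

/-- `K / F` is relatively perfect: `F(K ^ p) = K`. -/
def IsRelativelyPerfect (p : ℕ) (F K : Type*) [Field F] [Field K] [Algebra F K] : Prop :=
  IntermediateField.adjoin F (Set.range fun x : K => x ^ p) = ⊤

/-- The relatively perfect closure `rp(L / k)` of a subextension `L / k` of `K / k`: the greatest
relatively perfect subextension of `L / k` (see `isGreatest_rp`). -/
def rp (p : ℕ) {k K : Type*} [Field k] [Field K] [Algebra k K] (L : IntermediateField k K) :
    IntermediateField k K :=
  sSup {M : IntermediateField k K | M ≤ L ∧ IsRelativelyPerfect p k M}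

theorem isRelativelyPerfect_iff (p : ℕ) {k K : Type*} [Field k] [Field K] [Algebra k K]
    (M : IntermediateField k K) :
    IsRelativelyPerfect p k M ↔
      IntermediateField.adjoin k ((fun x : K => x ^ p) '' (M : Set K)) = M := by
  have key : (IntermediateField.adjoin k (Set.range fun x : M => x ^ p)).map M.val =
      IntermediateField.adjoin k ((fun x : K => x ^ p) '' (M : Set K)) := by
    rw [IntermediateField.adjoin_map]
    congr 1
    ext y
    constructor
    · rintro ⟨_, ⟨x, rfl⟩, rfl⟩
      exact ⟨x, x.2, by simp⟩
    · rintro ⟨x, hx, rfl⟩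
      exact ⟨_, ⟨⟨x, hx⟩, rfl⟩, by simp⟩
  have htop : (⊤ : IntermediateField k M).map M.val = M := by
    rw [← AlgHom.fieldRange_eq_map, IntermediateField.fieldRange_val]
  unfold IsRelativelyPerfect
  rw [← key]
  constructor
  · intro h
    rw [h, htop]
  · intro h
    exact IntermediateField.map_injective M.val (h.trans htop.symm)

theorem isGreatest_rp (p : ℕ) {k K : Type*} [Field k] [Field K] [Algebra k K]
    (L : IntermediateField k K) :
    IsGreatest {M : IntermediateField k K | M ≤ L ∧ IsRelativelyPerfect p k M} (rp p L) := by
  refine ⟨⟨sSup_le fun M hM => hM.1, ?_⟩, fun M hM => le_sSup hM⟩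
  rw [isRelativelyPerfect_iff]
  apply le_antisymm
  · rw [IntermediateField.adjoin_le_iff]
    rintro _ ⟨x, hx, rfl⟩
    exact pow_mem (show x ∈ rp p L from hx) p
  · refine sSup_le fun M hM => ?_
    conv_lhs => rw [← (isRelativelyPerfect_iff p M).1 hM.2]
    exact IntermediateField.adjoin.mono k _ _
      (Set.image_mono (show M ≤ rp p L from le_sSup hM))

/-- `lm(K / k)`: the smallest intermediate field `m` with `K / m` modular, defined as the
intersection of all of them. -/
def lm (p : ℕ) (k K : Type*) [Field k] [Field K] [Algebra k K] [ExpChar K p] :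
    IntermediateField k K :=
  sInf {m : IntermediateField k K | IsModular p m K}

/-- `lqm(K / k)`: the smallest intermediate field `m` with `K / m` lq-modular, defined as the
intersection of all of them. -/
def lqm (p : ℕ) (k K : Type*) [Field k] [Field K] [Algebra k K] [ExpChar K p] :
    IntermediateField k K :=
  sInf {m : IntermediateField k K | IsLqModular p m K}

end PurelyInsep

/-! Linear disjointness from a fixed field survives arbitrary intersections
(`LinearDisjointOverInf.iInf_right`), hence so does modularity, and `lm` exists. For lq-modularity,
the key is that `L ^ (p ^ (-n)) ∩ K` is finite over `L` for every intermediate field `L`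
(`IsQFinite.relfinrank_comap_ne_zero`). Two consequences follow: "finite over `m`" may be replaced
by "of bounded exponent over `m`" (`IsQFinite.isLqModular_iff`), and every intersection is already a
finite one (`IsQFinite.exists_finset_iInf_eq`). Intersecting finitely many witnesses `E i` keeps the
exponent bounded, so `lqm` exists. If `K / E` is modular and `E` has exponent at most `e` over
`lqm`, then it has exponent at most `e + 1` over `k(lqm ^ p)`; minimality makes `lqm` relatively
perfect. As `lm ≤ E`, `rp(lm)` has bounded exponent over `lqm`, and relative perfection forces it
into `lqm`. -/

namespace PurelyInsep

/-! ### Linear disjointness and intersections. -/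

section LinearDisjoint

variable {K : Type*} [Field K]

theorem linearDisjointOverInf_iff (A B : Subfield K) :
    LinearDisjointOverInf A B ↔ ∀ s : Finset K, (s : Set K) ⊆ B →
      LinearIndepOn (A ⊓ B : Subfield K) id (s : Set K) → LinearIndepOn A id (s : Set K) := by
  constructor
  · intro H s hs hi
    let b : s → Subfield.extendScalars (inf_le_right : A ⊓ B ≤ B) :=
      fun x => ⟨(x : K), hs x.2⟩
    have hb : LinearIndependent (A ⊓ B : Subfield K) b :=
      LinearIndependent.of_comp
        (Subfield.extendScalars (inf_le_right : A ⊓ B ≤ B)).val.toLinearMap hi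
    exact H.linearIndependent_right hb
  · intro H
    let b := Module.Basis.ofVectorSpace (A ⊓ B : Subfield K)
      (Subfield.extendScalars (inf_le_right : A ⊓ B ≤ B))
    refine IntermediateField.LinearDisjoint.of_basis_right b ?_
    have hb := b.linearIndependent.map'
      (Subfield.extendScalars (inf_le_right : A ⊓ B ≤ B)).val.toLinearMap
      (LinearMap.ker_eq_bot.2 Subtype.val_injective)
    set v : _ → K := (Subfield.extendScalars (inf_le_right : A ⊓ B ≤ B)).val ∘ b
    have hinj : Function.Injective v := Subtype.val_injective.comp b.injective
    have key : LinearIndepOn A id (Set.range v) := by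
      rw [linearIndepOn_iff_linearIndepOn_finset]
      intro s hs
      refine H s (hs.trans ?_) ?_
      · rintro _ ⟨i, rfl⟩
        exact (b i).2
      · exact (LinearIndependent.linearIndepOn_id hb).mono hs
    exact (linearIndepOn_id_range_iff hinj).1 key

theorem not_linearIndepOn_subfield_iff (A : Subfield K) (s : Finset K) :
    ¬ LinearIndepOn A id (s : Set K) ↔
      ∃ a : K → K, (∀ x, a x ∈ A) ∧ ∑ x ∈ s, a x * x = 0 ∧ ∃ x ∈ s, a x ≠ 0 := by
  rw [linearIndepOn_finset_iff]
  push Not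
  constructor
  · rintro ⟨f, h0, x, hx, hfx⟩
    exact ⟨fun x => f x, fun x => (f x).2, h0, x, hx, fun h => hfx (Subtype.ext h)⟩
  · rintro ⟨a, ha, h0, x, hx, hax⟩
    exact ⟨fun x => ⟨a x, ha x⟩, h0, x, hx, fun h => hax congr(($h : K))⟩

/-- If `A` is linearly disjoint from each `B i`, it is linearly disjoint from their intersection. -/
theorem LinearDisjointOverInf.iInf_right {ι : Sort*} {A : Subfield K} {B : ι → Subfield K}
    (h : ∀ i, LinearDisjointOverInf A (B i)) : LinearDisjointOverInf A (⨅ i, B i) := by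
  classical
  rw [linearDisjointOverInf_iff]
  intro s
  -- A dependent `s` all of whose proper subsets are independent carries only one relation over `A`,
  -- up to scaling.
  induction s using Finset.strongInduction with
  | _ s ih =>
  intro hs hi
  by_contra hdep
  obtain ⟨a, ha, h0, y, hy, hay⟩ := (not_linearIndepOn_subfield_iff A s).1 hdep
  have hmin : LinearIndepOn A id ((s.erase y : Finset K) : Set K) :=
    ih _ (Finset.erase_ssubset hy)
      ((Finset.coe_subset.2 (Finset.erase_subset y s)).trans hs)
      (hi.mono (Finset.coe_subset.2 (Finset.erase_subset y s)))
  have huniq : ∀ c : K → K, (∀ x, c x ∈ A) → ∑ x ∈ s, c x * x = 0 → c y = 0 →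
      ∀ x ∈ s, c x = 0 := by
    intro c hc hc0 hcy x hx
    by_contra hcx
    refine (not_linearIndepOn_subfield_iff A (s.erase y)).2 ⟨c, hc, ?_, x, ?_, hcx⟩ hmin
    · rw [← Finset.add_sum_erase s _ hy, hcy] at hc0
      simpa using hc0
    · exact Finset.mem_erase.2 ⟨fun hxy => hcx (by rw [hxy, hcy]), hx⟩
  -- Each `A ⊓ B i` supplies some relation; normalised at `y` it must be the unique one, whose
  -- coefficients thus lie in every `B i`.
  have hmem : ∀ x ∈ s, ∀ i, a x / a y ∈ B i := by
    intro x hx i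
    have hsi : (s : Set K) ⊆ B i := fun z hz => Subfield.mem_iInf.1 (hs hz) i
    obtain ⟨c, hc, hc0, z, hz, hcz⟩ := (not_linearIndepOn_subfield_iff (A ⊓ B i) s).1
      fun hli => hdep ((linearDisjointOverInf_iff A (B i)).1 (h i) s hsi hli)
    have hcy : c y ≠ 0 := fun hcy => hcz (huniq c (fun x => (hc x).1) hc0 hcy z hz)
    have := huniq (fun x => a x / a y - c x / c y)
      (fun x => sub_mem (div_mem (ha x) (ha y)) (div_mem (hc x).1 (hc y).1))
      (by simp_rw [sub_mul, div_mul_eq_mul_div, Finset.sum_sub_distrib, ← Finset.sum_div,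
            h0, hc0]; simp)
      (by simp [div_self hay, div_self hcy]) x hx
    rw [sub_eq_zero.1 this]
    exact div_mem (hc x).2 (hc y).2
  refine (not_linearIndepOn_subfield_iff (A ⊓ ⨅ i, B i) s).2
    ⟨fun x => if x ∈ s then a x / a y else 0, fun x => ?_, ?_, y, hy, ?_⟩ hi
  · dsimp only
    split_ifs with hx
    · exact Subfield.mem_inf.2 ⟨div_mem (ha x) (ha y), Subfield.mem_iInf.2 fun i => hmem x hx i⟩
    · exact zero_mem _
  · have : ∑ x ∈ s, a x * x / a y = 0 := by rw [← Finset.sum_div, h0, zero_div]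
    rw [← this]
    exact Finset.sum_congr rfl fun x hx => by simp only [if_pos hx, div_mul_eq_mul_div]
  · simp [hy, hay]

end LinearDisjoint

theorem isModular_iInf {ι : Sort*} (p : ℕ) {k K : Type*} [Field k] [Field K] [Algebra k K]
    [ExpChar K p] {F : ι → IntermediateField k K} (h : ∀ i, IsModular p (F i) K) :
    IsModular p (⨅ i, F i : IntermediateField k K) K := by
  have hr : ∀ E : IntermediateField k K, (algebraMap E K).fieldRange = E.toSubfield := by
    intro E
    ext x
    simp
  intro n
  rw [hr, IntermediateField.iInf_toSubfield]
  exact LinearDisjointOverInf.iInf_right fun i => hr (F i) ▸ h i n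

theorem isLeast_lm (p : ℕ) (k K : Type*) [Field k] [Field K] [Algebra k K] [ExpChar K p] :
    IsLeast {m : IntermediateField k K | IsModular p m K} (lm p k K) := by
  refine ⟨?_, fun m hm => sInf_le hm⟩
  have h : lm p k K = ⨅ m : {m : IntermediateField k K | IsModular p m K}, m.1 := sInf_eq_iInf' _
  rw [h]
  exact isModular_iInf p fun i => i.2

/-! ### Relative degrees; `relfinrank` is `0` for infinite degree, so `≠ 0` expresses finiteness. -/

section Relrank

variable {K : Type*} [Field K]

theorem relfinrank_sup_le {A B C : Subfield K} (hBA : B ≤ A) (hBC : B ≤ C)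
    (h : B.relfinrank A ≠ 0) : C.relfinrank (C ⊔ A) ≤ B.relfinrank A := by
  rw [Subfield.relfinrank_eq_finrank_of_le hBA] at h ⊢
  have : FiniteDimensional B (Subfield.extendScalars hBA) :=
    Module.finite_of_finrank_pos (Nat.pos_of_ne_zero h)
  let _ : Algebra B C := (Subfield.inclusion hBC).toAlgebra
  have : IsScalarTower B C K := IsScalarTower.of_algebraMap_eq' rfl
  have key := IntermediateField.adjoin_rank_le_of_isAlgebraic_right C (Subfield.extendScalars hBA)
  have heq : Subfield.extendScalars (le_sup_left : C ≤ C ⊔ A) =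
      IntermediateField.adjoin C (Subfield.extendScalars hBA : Set K) := by
    apply le_antisymm
    · have : C ⊔ A ≤ (IntermediateField.adjoin C
          (Subfield.extendScalars hBA : Set K)).toSubfield :=
        sup_le (fun x hx => IntermediateField.algebraMap_mem _ (⟨x, hx⟩ : C))
          fun x hx => IntermediateField.subset_adjoin C _ hx
      exact this
    · rw [IntermediateField.adjoin_le_iff]
      exact (le_sup_right : A ≤ C ⊔ A)
  rw [Subfield.relfinrank_eq_finrank_of_le le_sup_left, heq]
  exact Cardinal.toNat_le_toNat key (Module.rank_lt_aleph0 _ _)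

theorem relfinrank_sup_closure_singleton {L : Subfield K} {x : K} {q : ℕ} (hq : 0 < q)
    (hx : x ^ q ∈ L) : L.relfinrank (L ⊔ Subfield.closure {x}) ≠ 0 ∧
      L.relfinrank (L ⊔ Subfield.closure {x}) ≤ q := by
  have heq : Subfield.extendScalars (le_sup_left : L ≤ L ⊔ Subfield.closure {x}) =
      IntermediateField.adjoin L {x} := by
    apply le_antisymm
    · have : L ⊔ Subfield.closure {x} ≤ (IntermediateField.adjoin L {x}).toSubfield :=
        sup_le (fun x hx => IntermediateField.algebraMap_mem _ (⟨x, hx⟩ : L))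
          (Subfield.closure_le.2 (IntermediateField.subset_adjoin L _))
      exact this
    · rw [IntermediateField.adjoin_le_iff]
      exact Subfield.subset_closure.trans
        (le_sup_right : Subfield.closure {x} ≤ L ⊔ Subfield.closure {x})
  rw [Subfield.relfinrank_eq_finrank_of_le le_sup_left, heq]
  have hroot : Polynomial.aeval x (Polynomial.X ^ q - Polynomial.C (⟨x ^ q, hx⟩ : L)) = 0 := by
    rw [map_sub, map_pow, Polynomial.aeval_X, Polynomial.aeval_C]
    exact sub_self _
  have hmonic : (Polynomial.X ^ q - Polynomial.C (⟨x ^ q, hx⟩ : L)).Monic :=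
    Polynomial.monic_X_pow_sub_C _ hq.ne'
  have hint : IsIntegral L x := ⟨_, hmonic, hroot⟩
  have := IntermediateField.adjoin.finiteDimensional hint
  refine ⟨Module.finrank_pos.ne', ?_⟩
  rw [IntermediateField.adjoin.finrank hint]
  exact (Polynomial.natDegree_le_of_dvd (minpoly.dvd L x hroot) hmonic.ne_zero).trans
    (Polynomial.natDegree_X_pow_sub_C).le

theorem relfinrank_sup_closure_finset {L : Subfield K} {q : ℕ} (hq : 0 < q) (G : Finset K)
    (hG : ∀ x ∈ G, x ^ q ∈ L) : L.relfinrank (L ⊔ Subfield.closure (G : Set K)) ≠ 0 ∧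
      L.relfinrank (L ⊔ Subfield.closure (G : Set K)) ≤ q ^ G.card := by
  classical
  induction G using Finset.induction_on with
  | empty => simp
  | insert x G hx ih =>
    obtain ⟨h0, h1⟩ := ih fun y hy => hG y (Finset.mem_insert_of_mem hy)
    obtain ⟨h2, h3⟩ := relfinrank_sup_closure_singleton
      (L := L ⊔ Subfield.closure (G : Set K)) hq
      ((le_sup_left : L ≤ L ⊔ Subfield.closure (G : Set K)) (hG x (Finset.mem_insert_self x G)))
    have heq : L ⊔ Subfield.closure ((insert x G : Finset K) : Set K) =
        L ⊔ Subfield.closure (G : Set K) ⊔ Subfield.closure {x} := by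
      rw [Finset.coe_insert, Set.insert_eq, Set.union_comm, Subfield.closure_union, sup_assoc]
    rw [heq, ← Subfield.relfinrank_mul_relfinrank le_sup_left le_sup_left,
      Finset.card_insert_of_notMem hx, pow_succ]
    exact ⟨mul_ne_zero h0 h2, Nat.mul_le_mul h1 h3⟩

/-- The degree `[M : L(M ^ p)]` does not decrease along finite extensions of `M`. -/
theorem relfinrank_sup_map_frobenius_le (p : ℕ) [ExpChar K p] {L M N : Subfield K} (hLM : L ≤ M)
    (hMN : M ≤ N) (h : M.relfinrank N ≠ 0) :
    (L ⊔ M.map (frobenius K p)).relfinrank M ≤ (L ⊔ N.map (frobenius K p)).relfinrank N := by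
  have hpow : ∀ A : Subfield K, A.map (frobenius K p) ≤ A := by
    rintro A _ ⟨x, hx, rfl⟩
    exact pow_mem hx p
  have hmap : M.map (frobenius K p) ≤ N.map (frobenius K p) := (Subfield.gc_map_comap (frobenius K p)).monotone_l hMN
  have hle : L ⊔ M.map (frobenius K p) ≤ L ⊔ N.map (frobenius K p) := sup_le_sup_left hmap _
  have h1 := Subfield.relfinrank_mul_relfinrank (sup_le hLM (hpow M)) hMN
  have h2 := Subfield.relfinrank_mul_relfinrank hle (sup_le (hLM.trans hMN) (hpow N))
  -- Frobenius gives `[N ^ p : M ^ p] = [N : M]`, and adjoining `L` to both cannot increase the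
  -- degree.
  have h3 : (L ⊔ M.map (frobenius K p)).relfinrank (L ⊔ N.map (frobenius K p)) ≤
      M.relfinrank N := by
    have := relfinrank_sup_le (C := L ⊔ M.map (frobenius K p)) hmap le_sup_right
      (by rwa [Subfield.relfinrank_map_map])
    rwa [sup_assoc, sup_of_le_right hmap, Subfield.relfinrank_map_map] at this
  -- Compare the two factorisations of `[N : L(M ^ p)]` and cancel `[N : M]`.
  refine Nat.le_of_mul_le_mul_right ?_ (Nat.pos_of_ne_zero h)
  rw [h1, ← h2, mul_comm]
  exact Nat.mul_le_mul_left _ h3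

theorem card_le_relfinrank {L M : Subfield K} (hLM : L ≤ M) (h : L.relfinrank M ≠ 0)
    {s : Finset K} (hs : (s : Set K) ⊆ M) (hi : LinearIndepOn L id (s : Set K)) :
    s.card ≤ L.relfinrank M := by
  rw [Subfield.relfinrank_eq_finrank_of_le hLM] at h ⊢
  have : FiniteDimensional L (Subfield.extendScalars hLM) :=
    Module.finite_of_finrank_pos (Nat.pos_of_ne_zero h)
  let b : s → Subfield.extendScalars hLM := fun x => ⟨(x : K), hs x.2⟩
  have hb : LinearIndependent L b :=
    LinearIndependent.of_comp (Subfield.extendScalars hLM).val.toLinearMap hi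
  simpa using hb.fintype_card_le_finrank

end Relrank

/-! ### Finiteness of bounded-exponent extensions. -/

section QFinite

variable {p : ℕ} {k K : Type*} [Field k] [Field K] [Algebra k K] [ExpChar K p]

theorem exists_finset_adjoin_eq_rootField (h : irrDegree p k K ≠ ⊤) :
    ∃ r : ℕ, ∀ n, ∃ G : Finset K, G.card ≤ r ∧
      IntermediateField.adjoin k (G : Set K) = rootField p k K n := by
  obtain ⟨r, hr⟩ := ENat.ne_top_iff_exists.1 h
  refine ⟨r, fun n => ?_⟩
  have hlt : (⨅ G : {G : Set K // IsMinimalGenerator (rootField p k K n) G}, (G : Set K).encard)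
      < (r + 1 : ℕ∞) := by
    refine lt_of_le_of_lt (le_iSup (fun n => ⨅ G : {G : Set K //
      IsMinimalGenerator (rootField p k K n) G}, (G : Set K).encard) n) ?_
    change irrDegree p k K < _
    rw [← hr]
    exact_mod_cast Nat.lt_succ_self r
  obtain ⟨⟨G, hG⟩, hGr⟩ := iInf_lt_iff.1 hlt
  have hle : G.encard ≤ r := ENat.lt_add_one_iff (ENat.natCast_ne_top r) |>.1 hGr
  have hfin : G.Finite := Set.finite_of_encard_le_coe hle
  refine ⟨hfin.toFinset, ?_, by simpa using hG.1⟩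
  rw [hfin.encard_eq_coe_toFinset_card] at hle
  exact_mod_cast hle

theorem mem_rootField_iff {n : ℕ} {x : K} :
    x ∈ rootField p k K n ↔ x ^ p ^ n ∈ (algebraMap k K).fieldRange := by
  rfl

theorem rootField_mono : Monotone (rootField p k K) := by
  intro m n hmn x hx
  obtain ⟨d, rfl⟩ := Nat.exists_eq_add_of_le hmn
  rw [mem_rootField_iff] at hx ⊢
  rw [pow_add, pow_mul]
  exact pow_mem hx _

theorem toSubfield_eq_of_adjoin_eq {A : IntermediateField k K} {s : Set K}
    (hA : IntermediateField.adjoin k s = A) :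
    A.toSubfield = (algebraMap k K).fieldRange ⊔ Subfield.closure s := by
  rw [← hA, IntermediateField.adjoin_toSubfield, Subfield.closure_union]
  congr 1
  rw [← RingHom.coe_fieldRange, Subfield.closure_eq]

theorem exists_mem_rootField [IsPurelyInseparable k K] (x : K) : ∃ n, x ∈ rootField p k K n := by
  have := (algebraMap k K).expChar (algebraMap k K).injective p
  obtain ⟨n, y, hy⟩ := IsPurelyInseparable.pow_mem k p x
  exact ⟨n, y, hy⟩

theorem exists_subset_rootField [IsPurelyInseparable k K] (s : Finset K) :
    ∃ n, (s : Set K) ⊆ rootField p k K n := by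
  choose e he using exists_mem_rootField (p := p) (k := k) (K := K)
  exact ⟨s.sup e, fun x hx => rootField_mono (Finset.le_sup hx) (he x)⟩

/-- In a q-finite extension `K / k`, a linearly independent family of elements of exponent at most
`1` over an intermediate field `L` has bounded cardinality, uniformly in `L`. -/
theorem IsQFinite.exists_card_le (h : IsQFinite p k K) :
    ∃ N : ℕ, ∀ L : Subfield K, (algebraMap k K).fieldRange ≤ L → ∀ s : Finset K,
      (∀ x ∈ s, x ^ p ∈ L) → LinearIndepOn L id (s : Set K) → s.card ≤ N := by
  have := h.1
  have hp : 0 < p := expChar_pos K p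
  obtain ⟨r, hr⟩ := exists_finset_adjoin_eq_rootField h.2
  refine ⟨p ^ r, fun L hkL s hs hi => ?_⟩
  set k₀ : Subfield K := (algebraMap k K).fieldRange
  obtain ⟨n, hn⟩ := exists_subset_rootField (p := p) (k := k) s
  obtain ⟨G, hGr, hG⟩ := hr n
  set M : Subfield K := k₀ ⊔ Subfield.closure (s : Set K)
  set N : Subfield K := (rootField p k K n).toSubfield
  have hNG : N = k₀ ⊔ Subfield.closure (G : Set K) := toSubfield_eq_of_adjoin_eq hG
  have hGN : (G : Set K) ⊆ N := by
    rw [hNG]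
    exact Subfield.subset_closure.trans
      (le_sup_right : _ ≤ k₀ ⊔ Subfield.closure (G : Set K))
  have hkN : k₀ ≤ N := hNG ▸ le_sup_left
  have hMN : M ≤ N := sup_le hkN (Subfield.closure_le.2 hn)
  -- Only finiteness is kept here, since this degree bound depends on `n`.
  have hfin : k₀.relfinrank N ≠ 0 := by
    rw [hNG]
    exact (relfinrank_sup_closure_finset (pow_pos hp n) G fun x hx =>
      mem_rootField_iff.1 (show x ∈ N from hGN hx)).1
  rw [← Subfield.relfinrank_mul_relfinrank le_sup_left hMN] at hfin
  have hPM : k₀ ⊔ M.map (frobenius K p) ≤ M := by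
    refine sup_le le_sup_left ?_
    rintro _ ⟨x, hx, rfl⟩
    exact pow_mem hx p
  have hPL : k₀ ⊔ M.map (frobenius K p) ≤ L := by
    refine sup_le hkL (Subfield.map_le_iff_le_comap.2 (sup_le (fun x hx => ?_) ?_))
    · exact pow_mem (hkL hx) p
    · exact Subfield.closure_le.2 hs
  -- Independence descends from `L` to its subfield `k(M ^ p)`, over which `M = k(s)` has finite
  -- degree.
  have hi' : LinearIndepOn (k₀ ⊔ M.map (frobenius K p) : Subfield K) id (s : Set K) := by
    by_contra hcon
    obtain ⟨a, ha, ha'⟩ := (not_linearIndepOn_subfield_iff _ s).1 hcon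
    exact (not_linearIndepOn_subfield_iff L s).2 ⟨a, fun x => hPL (ha x), ha'⟩ hi
  have hPM0 : (k₀ ⊔ M.map (frobenius K p)).relfinrank M ≠ 0 := by
    have := left_ne_zero_of_mul hfin
    rw [← Subfield.relfinrank_mul_relfinrank le_sup_left hPM] at this
    exact right_ne_zero_of_mul this
  calc s.card ≤ (k₀ ⊔ M.map (frobenius K p)).relfinrank M :=
        card_le_relfinrank hPM hPM0 (Subfield.subset_closure.trans
          (le_sup_right : _ ≤ k₀ ⊔ Subfield.closure (s : Set K))) hi'
    _ ≤ (k₀ ⊔ N.map (frobenius K p)).relfinrank N :=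
        relfinrank_sup_map_frobenius_le p le_sup_left hMN (right_ne_zero_of_mul hfin)
    _ ≤ p ^ G.card := by
        -- Over `k(N ^ p)` the generators have exponent at most `1`, so the bound no longer involves
        -- `n`.
        have hGp : ∀ x ∈ G, x ^ p ∈ k₀ ⊔ N.map (frobenius K p) := fun x hx =>
          (le_sup_right : _ ≤ k₀ ⊔ N.map (frobenius K p)) ⟨x, hGN hx, rfl⟩
        have hle := (relfinrank_sup_closure_finset hp G hGp).2
        have heq : k₀ ⊔ N.map (frobenius K p) ⊔ Subfield.closure (G : Set K) = N := by
          apply le_antisymm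
          · refine sup_le (sup_le hkN ?_) (Subfield.closure_le.2 hGN)
            rintro _ ⟨x, hx, rfl⟩
            exact pow_mem hx p
          · calc N = k₀ ⊔ Subfield.closure (G : Set K) := hNG
              _ ≤ _ := sup_le_sup_right le_sup_left _
        rwa [heq] at hle
    _ ≤ p ^ r := Nat.pow_le_pow_right hp hGr

theorem le_comap_iterateFrobenius (L : Subfield K) (n : ℕ) :
    L ≤ L.comap (iterateFrobenius K p n) := fun _ hx => pow_mem hx (p ^ n)

/-- Climb one `p`-th root at a time: the bound of `IsQFinite.exists_card_le` applies to each new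
base field, hence the induction generalises `L`. -/
theorem IsQFinite.relfinrank_comap_ne_zero (h : IsQFinite p k K) (n : ℕ) {L : Subfield K}
    (hL : (algebraMap k K).fieldRange ≤ L) :
    L.relfinrank (L.comap (iterateFrobenius K p n)) ≠ 0 := by
  induction n generalizing L with
  | zero =>
    have : L.comap (iterateFrobenius K p 0) = L := by
      ext x
      simp
    rw [this, Subfield.relfinrank_self]
    exact one_ne_zero
  | succ n ih =>
    have h1 : L.relfinrank (L.comap (iterateFrobenius K p 1)) ≠ 0 := by
      obtain ⟨N, hN⟩ := h.exists_card_le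
      rw [Subfield.relfinrank_eq_finrank_of_le (le_comap_iterateFrobenius L 1)]
      set E := Subfield.extendScalars (le_comap_iterateFrobenius (p := p) L 1)
      have hrank : Module.rank L E ≤ N := by
        refine rank_le fun s hs => ?_
        have hinj : Function.Injective (fun i : s => ((i : E) : K)) :=
          Subtype.val_injective.comp Subtype.val_injective
        have hli : LinearIndependent L (fun i : s => ((i : E) : K)) :=
          hs.map' E.val.toLinearMap (LinearMap.ker_eq_bot.2 Subtype.val_injective)
        classical
        have hcard := hN L hL (s.image fun i : E => (i : K)) ?_ ?_
        · rwa [Finset.card_image_of_injective _ Subtype.val_injective] at hcard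
        · intro x hx
          obtain ⟨y, -, rfl⟩ := Finset.mem_image.1 hx
          have := y.2
          change (iterateFrobenius K p 1) y ∈ L at this
          rwa [iterateFrobenius_def, pow_one] at this
        · have := (linearIndepOn_id_range_iff hinj).2 hli
          convert this using 1
          ext x
          simp
      have : FiniteDimensional L E :=
        Module.rank_lt_aleph0_iff.1 (hrank.trans_lt (Cardinal.natCast_lt_aleph0))
      exact Module.finrank_pos.ne'
    have hcomap : L.comap (iterateFrobenius K p (n + 1)) =
        (L.comap (iterateFrobenius K p 1)).comap (iterateFrobenius K p n) := by
      ext x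
      simp only [Subfield.mem_comap, iterateFrobenius_def, ← pow_mul, pow_succ, pow_zero, one_mul]
    rw [hcomap, ← Subfield.relfinrank_mul_relfinrank (le_comap_iterateFrobenius L 1)
      (le_comap_iterateFrobenius _ n)]
    exact mul_ne_zero h1 (ih (hL.trans (le_comap_iterateFrobenius L 1)))

end QFinite
theorem relfinrank_lt_of_lt {K : Type*} [Field K] {L A B : Subfield K} (hLA : L ≤ A) (hAB : A < B)
    (h : L.relfinrank B ≠ 0) : L.relfinrank A < L.relfinrank B := by
  have hmul := Subfield.relfinrank_mul_relfinrank hLA hAB.le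
  rw [← hmul] at h ⊢
  have h0 := left_ne_zero_of_mul h
  have h1 := right_ne_zero_of_mul h
  have h2 : A.relfinrank B ≠ 1 := fun h2 => hAB.not_ge (Subfield.relfinrank_eq_one_iff.1 h2)
  exact lt_mul_of_one_lt_right (Nat.pos_of_ne_zero h0) (by omega)

/-! ### Intersections, lq-modularity and relative perfection. -/

section QFinite

variable {p : ℕ} {k K : Type*} [Field k] [Field K] [Algebra k K] [ExpChar K p]

theorem fieldRange_algebraMap_le (m : IntermediateField k K) :
    (algebraMap k K).fieldRange ≤ m.toSubfield := by
  rintro _ ⟨x, rfl⟩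
  exact m.algebraMap_mem x

theorem mem_iInf_iff {ι : Sort*} {F : ι → IntermediateField k K} {x : K} :
    x ∈ ⨅ i, F i ↔ ∀ i, x ∈ F i := by
  rw [← SetLike.mem_coe, IntermediateField.coe_iInf, Set.mem_iInter]
  rfl

/-- Take the last iterated `p`-th power of an element of `M` that still lies outside `L`. -/
theorem exists_pow_mem_of_not_le [IsPurelyInseparable k K] {L M : IntermediateField k K}
    (h : ¬ M ≤ L) : ∃ x ∈ M, x ∉ L ∧ x ^ p ∈ L := by
  classical
  obtain ⟨y, hyM, hyL⟩ := SetLike.not_le_iff_exists.1 h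
  have hex : ∃ n, y ^ p ^ n ∈ L := by
    obtain ⟨n, hn⟩ := exists_mem_rootField (p := p) (k := k) y
    exact ⟨n, fieldRange_algebraMap_le L hn⟩
  obtain ⟨n, hn⟩ : ∃ n, Nat.find hex = n + 1 := by
    refine Nat.exists_eq_succ_of_ne_zero fun h0 => hyL ?_
    simpa [h0] using Nat.find_spec hex
  refine ⟨y ^ p ^ n, pow_mem hyM _, Nat.find_min hex (by omega), ?_⟩
  rw [← pow_mul, ← pow_succ, ← hn]
  exact Nat.find_spec hex

/-- In a q-finite extension every intersection of intermediate fields is a finite intersection. -/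
theorem IsQFinite.exists_finset_iInf_eq (h : IsQFinite p k K) {ι : Type*}
    (F : ι → IntermediateField k K) : ∃ t : Finset ι, ⨅ i ∈ t, F i = ⨅ i, F i := by
  classical
  have := h.1
  set L : IntermediateField k K := ⨅ i, F i
  set R := L.toSubfield.comap (iterateFrobenius K p 1)
  have hLR : L.toSubfield ≤ R := le_comap_iterateFrobenius _ 1
  have hR : L.toSubfield.relfinrank R ≠ 0 :=
    h.relfinrank_comap_ne_zero 1 (fieldRange_algebraMap_le L)
  let I : Finset ι → Subfield K := fun t => R ⊓ (⨅ i ∈ t, F i : IntermediateField k K).toSubfield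
  have hle : ∀ t : Finset ι, L ≤ ⨅ i ∈ t, F i := fun t => le_iInf₂ fun i _ => iInf_le F i
  have hLI : ∀ t, L.toSubfield ≤ I t := fun t => le_inf hLR (hle t)
  -- Any strict inclusion over `L` is visible inside `R = L ^ (1/p) ∩ K`, which is finite over `L`;
  -- so minimising the degree of the trace on `R` suffices.
  let t := Function.argmin fun t => L.toSubfield.relfinrank (I t)
  refine ⟨t, le_antisymm ?_ (hle t)⟩
  by_contra hcon
  obtain ⟨x, hxt, hxL, hxp⟩ := exists_pow_mem_of_not_le (p := p) hcon
  obtain ⟨i, hi⟩ : ∃ i, x ∉ F i := by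
    by_contra! hall
    exact hxL (mem_iInf_iff.2 hall)
  have hxR : x ∈ R := by
    change iterateFrobenius K p 1 x ∈ L
    rwa [iterateFrobenius_def, pow_one]
  have hI : I (insert i t) = I t ⊓ (F i).toSubfield := by
    simp only [I, Finset.iInf_insert, IntermediateField.inf_toSubfield]
    rw [inf_assoc, inf_comm (F i).toSubfield]
  have hlt : I (insert i t) < I t := by
    refine lt_of_le_of_ne (hI ▸ inf_le_left) fun heq => hi ?_
    have hx : x ∈ I (insert i t) := heq ▸ Subfield.mem_inf.2 ⟨hxR, hxt⟩
    rw [hI] at hx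
    exact (Subfield.mem_inf.1 hx).2
  have hIt : L.toSubfield.relfinrank (I t) ≠ 0 := by
    rw [← Subfield.relfinrank_mul_relfinrank (hLI t) inf_le_left] at hR
    exact left_ne_zero_of_mul hR
  exact (relfinrank_lt_of_lt (hLI _) hlt hIt).not_ge
    (Function.argmin_le (fun t => L.toSubfield.relfinrank (I t)) _)

theorem IsQFinite.isLqModular_iff (h : IsQFinite p k K) (m : IntermediateField k K) :
    IsLqModular p m K ↔ ∃ E : IntermediateField k K, m ≤ E ∧
      (∃ e : ℕ, ∀ x ∈ E, x ^ p ^ e ∈ m) ∧ IsModular p E K := by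
  have := h.1
  constructor
  · rintro ⟨E, hE, hmod⟩
    refine ⟨E.restrictScalars k, fun x hx => E.algebraMap_mem ⟨x, hx⟩, ?_, hmod⟩
    have : ExpChar m p := (algebraMap m K).expChar (algebraMap m K).injective p
    have : IsPurelyInseparable m K := IsPurelyInseparable.tower_top k m K
    have : IsPurelyInseparable m E := IsPurelyInseparable.tower_bot m E K
    refine ⟨IsPurelyInseparable.exponent m E, fun x hx => ?_⟩
    obtain ⟨y, hy⟩ := IsPurelyInseparable.exponent_def' m p (⟨x, hx⟩ : E)
    have := congr(($hy : K))
    change x ^ p ^ _ ∈ m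
    rw [← show (y : K) = x ^ p ^ _ from this]
    exact y.2
  · rintro ⟨E, hmE, ⟨e, he⟩, hmod⟩
    refine ⟨IntermediateField.extendScalars hmE, ?_, hmod⟩
    have hne := h.relfinrank_comap_ne_zero e (fieldRange_algebraMap_le m)
    have hEle : E.toSubfield ≤ m.toSubfield.comap (iterateFrobenius K p e) := he
    rw [← Subfield.relfinrank_mul_relfinrank (B := E.toSubfield) hmE hEle] at hne
    have := left_ne_zero_of_mul hne
    rw [Subfield.relfinrank_eq_finrank_of_le hmE] at this
    exact Module.finite_of_finrank_pos (Nat.pos_of_ne_zero this)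

theorem IsModular.isLqModular {m : IntermediateField k K} (h : IsModular p m K)
    (hK : IsQFinite p k K) : IsLqModular p m K :=
  (hK.isLqModular_iff m).2 ⟨m, le_rfl, ⟨0, fun x hx => by simpa using hx⟩, h⟩

theorem IsQFinite.isLqModular_iInf (h : IsQFinite p k K) {ι : Type*}
    {F : ι → IntermediateField k K} (hF : ∀ i, IsLqModular p (F i) K) :
    IsLqModular p (⨅ i, F i : IntermediateField k K) K := by
  obtain ⟨t, ht⟩ := h.exists_finset_iInf_eq F
  choose E hFE e hE using fun i => (h.isLqModular_iff (F i)).1 (hF i)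
  choose e he using e
  rw [h.isLqModular_iff, ← ht]
  -- Finiteness of `t` is what makes a common exponent `t.sup e` available.
  refine ⟨⨅ i : t, E i, ?_, ⟨t.sup e, fun x hx => ?_⟩, isModular_iInf p fun i : t => hE i⟩
  · exact le_iInf fun i => (iInf₂_le i.1 i.2).trans (hFE i)
  · refine mem_iInf_iff.2 fun i => mem_iInf_iff.2 fun hi => ?_
    obtain ⟨d, hd⟩ := Nat.exists_eq_add_of_le (Finset.le_sup (f := e) hi)
    rw [hd, pow_add, pow_mul]
    exact pow_mem (he i x (mem_iInf_iff.1 hx ⟨i, hi⟩)) _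

theorem IsQFinite.isLeast_lqm (h : IsQFinite p k K) :
    IsLeast {m : IntermediateField k K | IsLqModular p m K} (lqm p k K) := by
  refine ⟨?_, fun m hm => sInf_le hm⟩
  have heq : lqm p k K = ⨅ m : {m : IntermediateField k K | IsLqModular p m K}, m.1 :=
    sInf_eq_iInf' _
  rw [heq]
  exact h.isLqModular_iInf fun i => i.2

theorem IsQFinite.isRelativelyPerfect_lqm (h : IsQFinite p k K) :
    IsRelativelyPerfect p k (lqm p k K) := by
  rw [isRelativelyPerfect_iff]
  set P := IntermediateField.adjoin k ((fun x : K => x ^ p) '' (lqm p k K : Set K)) with hP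
  have hPle : P ≤ lqm p k K := by
    rw [hP, IntermediateField.adjoin_le_iff]
    rintro _ ⟨x, hx, rfl⟩
    exact pow_mem (show x ∈ lqm p k K from hx) p
  refine le_antisymm hPle (h.isLeast_lqm.2 ?_)
  obtain ⟨E, hE, ⟨e, he⟩, hmod⟩ := (h.isLqModular_iff _).1 h.isLeast_lqm.1
  refine (h.isLqModular_iff P).2 ⟨E, hPle.trans hE, ⟨e + 1, fun x hx => ?_⟩, hmod⟩
  rw [pow_succ, pow_mul]
  exact IntermediateField.subset_adjoin k _ ⟨_, he x hx, rfl⟩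

theorem IsRelativelyPerfect.le_of_pow_mem {L M : IntermediateField k K}
    (hM : IsRelativelyPerfect p k M) {e : ℕ} (he : ∀ x ∈ M, x ^ p ^ e ∈ L) : M ≤ L := by
  induction e with
  | zero => exact fun x hx => by simpa using he x hx
  | succ e ih =>
    refine ih fun x hx => ?_
    suffices M.toSubfield ≤ L.toSubfield.comap (iterateFrobenius K p e) from this hx
    -- `L ^ (p ^ (-e)) ∩ K` contains `k` and `M ^ p`, hence `k(M ^ p) = M`: the exponent drops from
    -- `e + 1` to `e`.
    have hle : M ≤ ((L.toSubfield.comap (iterateFrobenius K p e)).toIntermediateField fun y =>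
        le_comap_iterateFrobenius _ e (L.algebraMap_mem y)) := by
      rw [← (isRelativelyPerfect_iff p M).1 hM, IntermediateField.adjoin_le_iff]
      rintro _ ⟨y, hy, rfl⟩
      change iterateFrobenius K p e (y ^ p) ∈ L
      rw [iterateFrobenius_def, ← pow_mul, ← pow_succ']
      exact he y hy
    exact hle

theorem IsQFinite.lqm_eq_rp_lm (h : IsQFinite p k K) : lqm p k K = rp p (lm p k K) := by
  apply le_antisymm
  · exact (isGreatest_rp p _).2
      ⟨h.isLeast_lqm.2 ((isLeast_lm p k K).1.isLqModular h), h.isRelativelyPerfect_lqm⟩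
  · obtain ⟨E, -, ⟨e, he⟩, hmod⟩ := (h.isLqModular_iff _).1 h.isLeast_lqm.1
    obtain ⟨hle, hperf⟩ := (isGreatest_rp p (lm p k K)).1
    exact hperf.le_of_pow_mem fun x hx => he x ((isLeast_lm p k K).2 hmod (hle hx))

end QFinite
end PurelyInsep

theorem propositionp316 (p : ℕ) [Fact p.Prime] (k K : Type*) [Field k] [Field K] [Algebra k K]
    [CharP K p] (hK : PurelyInsep.IsQFinite p k K) :
    (∀ (ι : Type*) (F : ι → IntermediateField k K),
      (∀ i, PurelyInsep.IsLqModular p (F i) K) →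
        PurelyInsep.IsLqModular p (⨅ i, F i : IntermediateField k K) K) ∧
    IsLeast {m : IntermediateField k K | PurelyInsep.IsModular p m K} (PurelyInsep.lm p k K) ∧
    IsLeast {m : IntermediateField k K | PurelyInsep.IsLqModular p m K}
      (PurelyInsep.lqm p k K) ∧
    PurelyInsep.lqm p k K = PurelyInsep.rp p (PurelyInsep.lm p k K) ∧
    PurelyInsep.IsRelativelyPerfect p k (PurelyInsep.lqm p k K) :=
  ⟨fun _ _ hF => hK.isLqModular_iInf hF, PurelyInsep.isLeast_lm p k K, hK.isLeast_lqm,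
    hK.lqm_eq_rp_lm, hK.isRelativelyPerfect_lqm⟩
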